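/- Let $V$ and $W$ be unitary operators with simple spectrum (that is, possessing a cyclic vector) in complex Hilbert spaces $\mathcal H$ and $\widetilde{\mathcal H}$ respectively, and let $k\ge 0$ be an integer. Assume that for each $i=1,\dots,k$ there are two sequences of natural numbers $n_t^{(i)}\to\infty$, $m_t^{(i)}\to\infty$ (as $t\to\infty$) and three complex numbers $\kappa_i$, $\widetilde\kappa_i$, $\delta_i$ with $\widetilde\kappa_i\ne\kappa_i$ and $\delta_i\neq 0$ such that the following limits hold in the weak operator topology as $t\to\infty$: (i) $V^{n_t^{(i)}}\to \kappa_i I+\delta_i V^*$ and $W^{n_t^{(i)}}\to \kappa_i I+\delta_i W^*$; (ii) $V^{m_t^{(i)}}\to \kappa_i I+\delta_i V^*$ and $W^{m_t^{(i)}}\to \widetilde\kappa_i I+\delta_i W^*$. Assume, moreover, that the numbers $\kappa_1/\delta_1,\dots,\kappa_k/\delta_k$ are pairwise distinct. Then $V^{\odot k}\otimes W$ has simple spectrum. Here $V^{\odot k}$ is the restriction of $V^{\otimes k}$ to the closed subspace $\mathcal H^{\odot k}\subset\mathcal H^{\otimes k}$ of tensors invariant under all permutations of the $k$ factors, all tensor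 products being Hilbert space tensor products (for $k=0$, $V^{\odot 0}$ is the identity of $\mathbb C$). -/

import Mathlib

open Filter Topology UniformSpace ContinuousLinearMap
open scoped TensorProduct InnerProductSpace ComplexOrder

noncomputable section

namespace SimpleSpectrum

/-! ### Extension of surjective isometries to completions -/

section Completion

variable {E F : Type*} [SeminormedAddCommGroup E] [InnerProductSpace ℂ E]
  [SeminormedAddCommGroup F] [InnerProductSpace ℂ F]

/-- The unitary map between the completions induced by a surjective linear isometry. -/
def completionUnitary (e : E ≃ₗᵢ[ℂ] F) : Completion E ≃ₗᵢ[ℂ] Completion F where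
  toFun := Completion.map e
  invFun := Completion.map e.symm
  map_add' x y := by
    induction x, y using Completion.induction_on₂ with
    | hp =>
      refine isClosed_eq (Completion.continuous_map.comp continuous_add) (Continuous.add ?_ ?_)
      · exact Completion.continuous_map.comp continuous_fst
      · exact Completion.continuous_map.comp continuous_snd
    | ih x y =>
      rw [← Completion.coe_add, Completion.map_coe e.isometry.uniformContinuous,
        Completion.map_coe e.isometry.uniformContinuous,
        Completion.map_coe e.isometry.uniformContinuous, map_add, Completion.coe_add]
  map_smul' c x := by
    induction x using Completion.induction_on with
    | hp =>
      exact isClosed_eq (Completion.continuous_map.comp (continuous_const_smul c))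
        ((continuous_const_smul c).comp Completion.continuous_map)
    | ih x =>
      simp only [RingHom.id_apply]
      rw [← Completion.coe_smul, Completion.map_coe e.isometry.uniformContinuous,
        Completion.map_coe e.isometry.uniformContinuous, map_smul, Completion.coe_smul]
  left_inv x := by
    induction x using Completion.induction_on with
    | hp =>
      exact isClosed_eq (Completion.continuous_map.comp Completion.continuous_map) continuous_id
    | ih x =>
      rw [Completion.map_coe e.isometry.uniformContinuous,
        Completion.map_coe e.symm.isometry.uniformContinuous, e.symm_apply_apply]
  right_inv x := by
    induction x using Completion.induction_on with
    | hp =>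
      exact isClosed_eq (Completion.continuous_map.comp Completion.continuous_map) continuous_id
    | ih x =>
      rw [Completion.map_coe e.symm.isometry.uniformContinuous,
        Completion.map_coe e.isometry.uniformContinuous, e.apply_symm_apply]
  norm_map' x := by
    induction x using Completion.induction_on with
    | hp => exact isClosed_eq Completion.continuous_map.norm continuous_norm
    | ih x =>
      change ‖Completion.map e x‖ = _
      rw [Completion.map_coe e.isometry.uniformContinuous, Completion.norm_coe,
        Completion.norm_coe, e.norm_map]

@[simp]
theorem completionUnitary_coe (e : E ≃ₗᵢ[ℂ] F) (x : E) :
    completionUnitary e (x : Completion E) = (e x : Completion F) :=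
  Completion.map_coe e.isometry.uniformContinuous x

end Completion

/-! ### The Hilbert space tensor product of two spaces -/

section Two

variable {E F : Type*} [NormedAddCommGroup E] [InnerProductSpace ℂ E]
  [NormedAddCommGroup F] [InnerProductSpace ℂ F]

/-- The unitary `A ⊗ B` on the Hilbert space tensor product, which is the completion of the
algebraic tensor product for the inner product `⟪x ⊗ y, x' ⊗ y'⟫ = ⟪x, x'⟫ ⟪y, y'⟫`. -/
def tensorUnitary (A : E ≃ₗᵢ[ℂ] E) (B : F ≃ₗᵢ[ℂ] F) :
    Completion (E ⊗[ℂ] F) ≃ₗᵢ[ℂ] Completion (E ⊗[ℂ] F) :=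
  completionUnitary (TensorProduct.congrIsometry A B)

end Two

/-! ### Tensor powers of a Hilbert space -/

/-- The algebraic tensor power `H ⊗ ⋯ ⊗ H` (`k` factors). This is a copy of the type of Mathlib,
since it carries the Hilbert seminorm below, not the projective one. -/
def AlgPower (k : ℕ) (H : Type*) [NormedAddCommGroup H] [InnerProductSpace ℂ H] : Type _ :=
  PiTensorProduct ℂ (fun _ : Fin k => H)

section Power

variable {k : ℕ} {H : Type*} [NormedAddCommGroup H] [InnerProductSpace ℂ H]

instance : AddCommGroup (AlgPower k H) :=
  inferInstanceAs (AddCommGroup (PiTensorProduct ℂ (fun _ : Fin k => H)))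

instance : Module ℂ (AlgPower k H) :=
  inferInstanceAs (Module ℂ (PiTensorProduct ℂ (fun _ : Fin k => H)))

/-- The elementary tensor `x 0 ⊗ ⋯ ⊗ x (k - 1)`. -/
def AlgPower.tprod : MultilinearMap ℂ (fun _ : Fin k => H) (AlgPower k H) :=
  PiTensorProduct.tprod ℂ

theorem AlgPower.span_tprod : Submodule.span ℂ (Set.range (AlgPower.tprod (k := k) (H := H))) = ⊤ :=
  PiTensorProduct.span_tprod_eq_top

/-- Linear maps out of the algebraic tensor power. -/
def AlgPower.lift {M : Type*} [AddCommGroup M] [Module ℂ M]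
    (f : MultilinearMap ℂ (fun _ : Fin k => H) M) : AlgPower k H →ₗ[ℂ] M :=
  PiTensorProduct.lift f

@[simp]
theorem AlgPower.lift_tprod {M : Type*} [AddCommGroup M] [Module ℂ M]
    (f : MultilinearMap ℂ (fun _ : Fin k => H) M) (x : Fin k → H) :
    AlgPower.lift f (AlgPower.tprod x) = f x :=
  PiTensorProduct.lift.tprod x

theorem AlgPower.induction {p : AlgPower k H → Prop}
    (h : ∀ (c : ℂ) (x : Fin k → H), p (c • AlgPower.tprod x))
    (hadd : ∀ x y, p x → p y → p (x + y)) (x : AlgPower k H) : p x :=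
  PiTensorProduct.induction_on (motive := p) x h hadd

/-- The functional `y ↦ ∏ ⟪x l, y l⟫`. -/
def AlgPower.functional (x : Fin k → H) : AlgPower k H →ₗ[ℂ] ℂ :=
  AlgPower.lift ((MultilinearMap.mkPiAlgebra ℂ (Fin k) ℂ).compLinearMap
    fun l => innerₛₗ ℂ (x l))

@[simp]
theorem AlgPower.functional_tprod (x y : Fin k → H) :
    AlgPower.functional x (AlgPower.tprod y) = ∏ l, ⟪x l, y l⟫_ℂ := by
  simp [AlgPower.functional]

theorem AlgPower.functional_update_add [DecidableEq (Fin k)] (x : Fin k → H) (i : Fin k)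
    (a b : H) (y : AlgPower k H) :
    AlgPower.functional (Function.update x i (a + b)) y =
      AlgPower.functional (Function.update x i a) y +
        AlgPower.functional (Function.update x i b) y := by
  induction y using AlgPower.induction with
  | h c y =>
    simp only [map_smul, AlgPower.functional_tprod, ← smul_add]
    congr 1
    rw [← Finset.mul_prod_erase _ _ (Finset.mem_univ i),
      ← Finset.mul_prod_erase _ (fun l => ⟪Function.update x i a l, y l⟫_ℂ) (Finset.mem_univ i),
      ← Finset.mul_prod_erase _ (fun l => ⟪Function.update x i b l, y l⟫_ℂ) (Finset.mem_univ i)]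
    have h (v : H) : ∏ l ∈ Finset.univ.erase i, ⟪Function.update x i v l, y l⟫_ℂ =
        ∏ l ∈ Finset.univ.erase i, ⟪x l, y l⟫_ℂ :=
      Finset.prod_congr rfl fun l hl => by
        rw [Function.update_of_ne (Finset.ne_of_mem_erase hl)]
    simp only [h, Function.update_self, inner_add_left, add_mul]
  | hadd y z hy hz => simp only [map_add, hy, hz]; ring

theorem AlgPower.functional_update_smul [DecidableEq (Fin k)] (x : Fin k → H) (i : Fin k)
    (c : ℂ) (a : H) (y : AlgPower k H) :
    AlgPower.functional (Function.update x i (c • a)) y =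
      star c * AlgPower.functional (Function.update x i a) y := by
  induction y using AlgPower.induction with
  | h d y =>
    simp only [map_smul, AlgPower.functional_tprod, smul_eq_mul]
    rw [← Finset.mul_prod_erase _ _ (Finset.mem_univ i),
      ← Finset.mul_prod_erase _ (fun l => ⟪Function.update x i a l, y l⟫_ℂ) (Finset.mem_univ i)]
    have h (v : H) : ∏ l ∈ Finset.univ.erase i, ⟪Function.update x i v l, y l⟫_ℂ =
        ∏ l ∈ Finset.univ.erase i, ⟪x l, y l⟫_ℂ :=
      Finset.prod_congr rfl fun l hl => by
        rw [Function.update_of_ne (Finset.ne_of_mem_erase hl)]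
    simp only [h, Function.update_self, inner_smul_left, starRingEnd_apply]
    ring
  | hadd y z hy hz => simp only [map_add, hy, hz]; ring

/-- The conjugate of the functional `x ↦ ∏ ⟪y l, x l⟫`, as a multilinear map of `y`; its value on
an elementary tensor is `∏ ⟪x l, y l⟫`. -/
def AlgPower.conjFunctional :
    MultilinearMap ℂ (fun _ : Fin k => H) (AlgPower k H →ₗ⋆[ℂ] ℂ) where
  toFun y :=
    { toFun := fun x => star (AlgPower.functional y x)
      map_add' := fun a b => by simp
      map_smul' := fun c a => by simp }
  map_update_add' y i a b := by
    ext x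
    simp [AlgPower.functional_update_add]
  map_update_smul' y i c a := by
    ext x
    simp [AlgPower.functional_update_smul]

/-- The inner product of `H ⊗ ⋯ ⊗ H`, determined by sesquilinearity and
`⟪x 0 ⊗ ⋯, y 0 ⊗ ⋯⟫ = ∏ ⟪x l, y l⟫`. -/
instance : Inner ℂ (AlgPower k H) where
  inner x y := AlgPower.lift AlgPower.conjFunctional y x

theorem AlgPower.inner_def (x y : AlgPower k H) :
    ⟪x, y⟫_ℂ = AlgPower.lift AlgPower.conjFunctional y x := rfl

theorem AlgPower.inner_tprod_tprod (x y : Fin k → H) :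
    ⟪AlgPower.tprod x, AlgPower.tprod y⟫_ℂ = ∏ l, ⟪x l, y l⟫_ℂ := by
  rw [AlgPower.inner_def, AlgPower.lift_tprod]
  change star (AlgPower.functional y (AlgPower.tprod x)) = _
  simp [star_prod]

theorem AlgPower.inner_sum_sum {ι : Type*} (s : Finset ι) (c : ι → ℂ) (v : ι → Fin k → H) :
    ⟪∑ i ∈ s, c i • AlgPower.tprod (v i), ∑ j ∈ s, c j • AlgPower.tprod (v j)⟫_ℂ =
      ∑ i ∈ s, ∑ j ∈ s, star (c i) * c j * ∏ l, ⟪v i l, v j l⟫_ℂ := by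
  have h (i j : ι) : AlgPower.lift AlgPower.conjFunctional (AlgPower.tprod (v j))
      (AlgPower.tprod (v i)) = ∏ l, ⟪v i l, v j l⟫_ℂ := AlgPower.inner_tprod_tprod _ _
  simp only [AlgPower.inner_def, map_sum, LinearMap.sum_apply, map_smul, LinearMap.map_smulₛₗ,
    LinearMap.smul_apply, h]
  rw [Finset.sum_comm]
  simp only [smul_eq_mul, Finset.mul_sum, RCLike.star_def]
  rw [Finset.sum_comm]
  refine Finset.sum_congr rfl fun i _ => Finset.sum_congr rfl fun j _ => ?_
  ring

/-- Hadamard products of Gram matrices are positive semidefinite. -/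
theorem posSemidef_prod_gram {ι : Type*} [Fintype ι] (v : ι → Fin k → H) (t : Finset (Fin k)) :
    (Matrix.of fun i j => ∏ l ∈ t, ⟪v i l, v j l⟫_ℂ).PosSemidef := by
  classical
  induction t using Finset.induction_on with
  | empty =>
    have h : (Matrix.of fun i j => ∏ l ∈ (∅ : Finset (Fin k)), ⟪v i l, v j l⟫_ℂ) =
        Matrix.gram ℂ (fun _ : ι => (1 : ℂ)) := by
      ext i j
      simp
    rw [h]
    exact Matrix.posSemidef_gram ℂ _
  | insert a t ha ih =>
    have h : (Matrix.of fun i j => ∏ l ∈ insert a t, ⟪v i l, v j l⟫_ℂ) =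
        (Matrix.gram ℂ fun i => v i a).hadamard (Matrix.of fun i j => ∏ l ∈ t, ⟪v i l, v j l⟫_ℂ) := by
      ext i j
      simp [Finset.prod_insert ha]
    rw [h]
    exact (Matrix.posSemidef_gram ℂ _).hadamard ih

instance : PreInnerProductSpace.Core ℂ (AlgPower k H) where
  conj_inner_symm x y := by
    induction x using AlgPower.induction with
    | h c x =>
      induction y using AlgPower.induction with
      | h d y =>
        have h := AlgPower.inner_tprod_tprod x y
        have h' := AlgPower.inner_tprod_tprod y x
        rw [AlgPower.inner_def] at h h'
        rw [AlgPower.inner_def, AlgPower.inner_def]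
        simp only [map_smul, LinearMap.map_smulₛₗ, LinearMap.smul_apply, h, h', smul_eq_mul,
          map_mul, map_prod, inner_conj_symm, Complex.conj_conj]
        ring
      | hadd y z hy hz =>
        simp only [AlgPower.inner_def, map_add, LinearMap.add_apply] at hy hz ⊢
        rw [hy, hz]
    | hadd x z hx hz =>
      simp only [AlgPower.inner_def, map_add, LinearMap.add_apply] at hx hz ⊢
      rw [hx, hz]
  re_inner_nonneg x := by
    have hx : x ∈ Submodule.span ℂ (Set.range (AlgPower.tprod (k := k) (H := H))) := by
      rw [AlgPower.span_tprod]; trivial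
    obtain ⟨c, rfl⟩ := Finsupp.mem_span_range_iff_exists_finsupp.1 hx
    rw [Finsupp.sum, AlgPower.inner_sum_sum]
    have h := (posSemidef_prod_gram (fun i : c.support => (i : Fin k → H))
      Finset.univ).dotProduct_mulVec_nonneg (fun i => c i)
    rw [RCLike.nonneg_iff] at h
    convert h.1 using 2
    simp only [dotProduct, Matrix.mulVec, Matrix.of_apply, Pi.star_apply, Finset.mul_sum]
    rw [← Finset.sum_coe_sort c.support]
    refine Finset.sum_congr rfl fun i _ => ?_
    rw [← Finset.sum_coe_sort c.support]
    refine Finset.sum_congr rfl fun j _ => ?_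
    ring
  add_left x y z := map_add _ _ _
  smul_left x y c := LinearMap.map_smulₛₗ _ _ _

instance : SeminormedAddCommGroup (AlgPower k H) :=
  InnerProductSpace.Core.toSeminormedAddCommGroup (𝕜 := ℂ)

instance : InnerProductSpace ℂ (AlgPower k H) := .ofCore _

/-- A linear bijection that preserves inner products of elementary tensors is an isometry. -/
def AlgPower.isometryOf (f g : AlgPower k H →ₗ[ℂ] AlgPower k H)
    (hfg : ∀ x, f (g (AlgPower.tprod x)) = AlgPower.tprod x)
    (hgf : ∀ x, g (f (AlgPower.tprod x)) = AlgPower.tprod x)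
    (h : ∀ x y, ⟪f (AlgPower.tprod x), f (AlgPower.tprod y)⟫_ℂ =
      ⟪(AlgPower.tprod x : AlgPower k H), AlgPower.tprod y⟫_ℂ) :
    AlgPower k H ≃ₗᵢ[ℂ] AlgPower k H :=
  LinearEquiv.isometryOfInner
    (LinearEquiv.ofLinearMap f g
      (LinearMap.ext fun x => by
        induction x using AlgPower.induction with
        | h c x => simp [hfg]
        | hadd x y hx hy => rw [map_add, map_add, hx, hy])
      (LinearMap.ext fun x => by
        induction x using AlgPower.induction with
        | h c x => simp [hgf]
        | hadd x y hx hy => rw [map_add, map_add, hx, hy]))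
    fun x y => by
      change ⟪f x, f y⟫_ℂ = ⟪x, y⟫_ℂ
      induction x using AlgPower.induction with
      | h c x =>
        induction y using AlgPower.induction with
        | h d y => simp only [map_smul, inner_smul_left, inner_smul_right, h]
        | hadd y z hy hz => simp only [map_add, inner_add_right, hy, hz]
      | hadd x z hx hz => simp only [map_add, inner_add_left, hx, hz]

/-- The linear map `x 0 ⊗ ⋯ ⊗ x (k - 1) ↦ V (x 0) ⊗ ⋯ ⊗ V (x (k - 1))`. -/
def AlgPower.map (V : H ≃ₗᵢ[ℂ] H) : AlgPower k H →ₗ[ℂ] AlgPower k H :=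
  AlgPower.lift (AlgPower.tprod.compLinearMap fun _ => (V.toLinearEquiv : H →ₗ[ℂ] H))

@[simp]
theorem AlgPower.map_tprod (V : H ≃ₗᵢ[ℂ] H) (x : Fin k → H) :
    AlgPower.map V (AlgPower.tprod x) = AlgPower.tprod fun l => V (x l) := by
  simp [AlgPower.map]

/-- The linear map `x 0 ⊗ ⋯ ⊗ x (k - 1) ↦ x (σ 0) ⊗ ⋯ ⊗ x (σ (k - 1))`. -/
def AlgPower.perm (σ : Equiv.Perm (Fin k)) : AlgPower k H →ₗ[ℂ] AlgPower k H :=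
  AlgPower.lift (AlgPower.tprod.domDomCongr σ)

@[simp]
theorem AlgPower.perm_tprod (σ : Equiv.Perm (Fin k)) (x : Fin k → H) :
    AlgPower.perm σ (AlgPower.tprod x) = AlgPower.tprod fun l => x (σ l) := by
  simp [AlgPower.perm]

variable (k H) in
/-- The Hilbert space tensor power `H ⊗ ⋯ ⊗ H` (`k` factors). -/
abbrev TensorPower : Type _ := Completion (AlgPower k H)

variable (k) in
/-- The unitary `V ⊗ ⋯ ⊗ V` (`k` factors). -/
def tensorPowerUnitary (V : H ≃ₗᵢ[ℂ] H) : TensorPower k H ≃ₗᵢ[ℂ] TensorPower k H :=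
  completionUnitary <| AlgPower.isometryOf (AlgPower.map V) (AlgPower.map V.symm)
    (fun x => by simp) (fun x => by simp)
    (fun x y => by simp [AlgPower.inner_tprod_tprod])

variable (H) in
/-- The unitary that permutes the factors of `H ⊗ ⋯ ⊗ H` by `σ`. -/
def permUnitary (σ : Equiv.Perm (Fin k)) : TensorPower k H ≃ₗᵢ[ℂ] TensorPower k H :=
  completionUnitary <| AlgPower.isometryOf (AlgPower.perm σ) (AlgPower.perm σ.symm)
    (fun x => by simp) (fun x => by simp)
    (fun x y => by
      simp only [AlgPower.perm_tprod, AlgPower.inner_tprod_tprod]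
      exact Equiv.prod_comp σ fun l => ⟪x l, y l⟫_ℂ)

theorem tensorPowerUnitary_tprod (V : H ≃ₗᵢ[ℂ] H) (x : Fin k → H) :
    tensorPowerUnitary k V (AlgPower.tprod x : AlgPower k H) =
      (AlgPower.tprod (fun l => V (x l)) : AlgPower k H) := by
  rw [tensorPowerUnitary, completionUnitary_coe]
  exact congrArg _ (AlgPower.map_tprod V x)

theorem permUnitary_tprod (σ : Equiv.Perm (Fin k)) (x : Fin k → H) :
    permUnitary H σ (AlgPower.tprod x : AlgPower k H) =
      (AlgPower.tprod (fun l => x (σ l)) : AlgPower k H) := by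
  rw [permUnitary, completionUnitary_coe]
  exact congrArg _ (AlgPower.perm_tprod σ x)

theorem permUnitary_tensorPowerUnitary (σ : Equiv.Perm (Fin k)) (V : H ≃ₗᵢ[ℂ] H)
    (x : TensorPower k H) :
    permUnitary H σ (tensorPowerUnitary k V x) = tensorPowerUnitary k V (permUnitary H σ x) := by
  induction x using Completion.induction_on with
  | hp =>
    exact isClosed_eq ((permUnitary H σ).continuous.comp (tensorPowerUnitary k V).continuous)
      ((tensorPowerUnitary k V).continuous.comp (permUnitary H σ).continuous)
  | ih x =>
    induction x using AlgPower.induction with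
    | h c x =>
      simp only [Completion.coe_smul, map_smul, tensorPowerUnitary_tprod, permUnitary_tprod]
    | hadd x y hx hy => simp only [Completion.coe_add, map_add, hx, hy]

theorem tensorPowerUnitary_symm_apply (V : H ≃ₗᵢ[ℂ] H) (x : TensorPower k H) :
    (tensorPowerUnitary k V).symm x = tensorPowerUnitary k V.symm x := rfl

variable (k H) in
/-- The symmetric tensor power `H ⊙ ⋯ ⊙ H` (`k` factors): the closed subspace of the tensors in
`H ⊗ ⋯ ⊗ H` that are fixed by all permutations of the factors. -/
def SymPower : Submodule ℂ (TensorPower k H) where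
  carrier := {x | ∀ σ : Equiv.Perm (Fin k), permUnitary H σ x = x}
  add_mem' hx hy σ := by rw [map_add, hx σ, hy σ]
  zero_mem' σ := map_zero _
  smul_mem' c x hx σ := by rw [map_smul, hx σ]

theorem tensorPowerUnitary_mem (V : H ≃ₗᵢ[ℂ] H) {x : TensorPower k H} (hx : x ∈ SymPower k H) :
    tensorPowerUnitary k V x ∈ SymPower k H := fun σ => by
  rw [permUnitary_tensorPowerUnitary, hx σ]

variable (k) in
/-- The symmetric power of the unitary `V`: the restriction of `V ⊗ ⋯ ⊗ V` to the symmetric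
tensors. -/
def symPowerUnitary (V : H ≃ₗᵢ[ℂ] H) : SymPower k H ≃ₗᵢ[ℂ] SymPower k H where
  toFun x := ⟨tensorPowerUnitary k V x, tensorPowerUnitary_mem V x.2⟩
  invFun x := ⟨tensorPowerUnitary k V.symm x, tensorPowerUnitary_mem V.symm x.2⟩
  map_add' x y := Subtype.ext (map_add (tensorPowerUnitary k V) (x : TensorPower k H) y)
  map_smul' c x := Subtype.ext (map_smul (tensorPowerUnitary k V) c (x : TensorPower k H))
  left_inv x := Subtype.ext ((tensorPowerUnitary k V).symm_apply_apply x)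
  right_inv x := Subtype.ext ((tensorPowerUnitary k V).apply_symm_apply x)
  norm_map' x := (tensorPowerUnitary k V).norm_map x

end Power

/-! ### Simple spectrum and weak limits of powers -/

/-- A unitary `U` has simple spectrum if it has a cyclic vector: some `x` such that the vectors
`U ^ n x`, `n ∈ ℤ`, span a dense subspace. -/
def HasSimpleSpectrum {E : Type*} [NormedAddCommGroup E] [InnerProductSpace ℂ E]
    (U : E ≃ₗᵢ[ℂ] E) : Prop :=
  ∃ x : E, (Submodule.span ℂ (Set.range fun n : ℤ => (U ^ n) x)).topologicalClosure = ⊤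

/-- `U ^ (n t) → κ I + δ U*` in the weak operator topology as `t → ∞`. -/
def PowersTendstoWeakly {E : Type*} [NormedAddCommGroup E] [InnerProductSpace ℂ E]
    [CompleteSpace E] (U : E ≃ₗᵢ[ℂ] E) (n : ℕ → ℕ) (κ δ : ℂ) : Prop :=
  Tendsto
    (fun t => ContinuousLinearMapWOT.ofCLM ((U.toContinuousLinearEquiv : E →L[ℂ] E) ^ n t))
    atTop
    (𝓝 (ContinuousLinearMapWOT.ofCLM
      (κ • (1 : E →L[ℂ] E) + δ • adjoint (U.toContinuousLinearEquiv : E →L[ℂ] E))))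

end SimpleSpectrum

end

/-!
Let `x` and `y` be cyclic for `V` and `W`, and let `L` be the cyclic subspace of the unitary
`U = V ⊙ ⋯ ⊙ V ⊗ W` that is generated by `v`, the symmetrization of `x ⊗ ⋯ ⊗ x ⊗ y`. The claim is
that `L` is everything.

The closed subspace `L` is weakly closed, hence invariant under the weak limits of powers of `U`.
Along `n i` and `m i` these are `(κ + δ V⁻¹) ⊙ ⋯ ⊙ (κ + δ V⁻¹)`, tensored with `κ + δ W⁻¹` and with
`κ' + δ W⁻¹`. Their difference is a nonzero multiple of an operator that is the identity on the
last factor. So `L` is invariant under `∏ l, (r i + V_l⁻¹)` with `r i = κ i / δ i`, where `V_l` is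
`V` acting on the `l`-th factor (`orbitVector_prod_mul_mem`).

The `k` numbers `r i` being distinct, the polynomials `∏ l, (r i + X l)` generate the algebra of
symmetric polynomials (`symmetricSubalgebra_le_adjoin`: a Vandermonde inversion gives the elementary
symmetric polynomials, and these suffice by the fundamental theorem). So `p(V_0⁻¹, …, V_{k-1}⁻¹) v`
belongs to `L` for every symmetric `p` (`orbitVector_mem_cyclicSubspace`). Taking adjoints in the
hypotheses gives the same for `V` in place of `V⁻¹`. In particular `V ⊙ ⋯ ⊙ V ⊗ 1` maps `v` into
`L`, and so does its inverse; commuting with `U`, it maps `L` onto itself. Hence so does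
`1 ⊙ ⋯ ⊙ 1 ⊗ W`, and `L` contains the symmetrizations of all
`V ^ c 0 x ⊗ ⋯ ⊗ V ^ c (k - 1) x ⊗ W ^ b y` with `c l, b ∈ ℤ`. These are total
(`eq_top_of_symTprod_zpow_mem`).

Operators such as `p(V_0⁻¹, …, V_{k-1}⁻¹)` are never formed: the linear map `orbitTensor` sends a
polynomial to the vector that it produces from `x ⊗ ⋯ ⊗ x`.
-/

noncomputable section

namespace SimpleSpectrum

/-! ### Symmetric polynomials -/

section SymmetricPolynomials

open MvPolynomial

/-- At `k` distinct values `r i`, the products `∏ l, (r i + X l)` generate the algebra of symmetric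
polynomials: up to the constant `r i ^ k`, they are combinations of the `k` elementary symmetric
polynomials of positive degree, with an invertible Vandermonde matrix of coefficients. -/
theorem symmetricSubalgebra_le_adjoin {F : Type*} [Field F] {k : ℕ} {r : Fin k → F}
    (hr : Function.Injective r) :
    symmetricSubalgebra (Fin k) F ≤
      Algebra.adjoin F (Set.range fun i => ∏ l : Fin k, (C (r i) + X l)) := by
  set A := Algebra.adjoin F (Set.range fun i => ∏ l : Fin k, (C (r i) + X l))
  have hexp (i : Fin k) : ∏ l : Fin k, (C (r i) + X l : MvPolynomial (Fin k) F) =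
      C (r i) ^ k + ∑ j : Fin k, (Matrix.vandermonde r i j) • esymm (Fin k) F (k - j) := by
    -- Expand the product over the sets `t` of the factors that contribute their variable, and group
    -- these by the number `j = k - #t` of the constants; `t = ∅` gives `r i ^ k`.
    rw [Finset.prod_congr rfl fun l _ => add_comm _ _, Finset.prod_add,
      ← Finset.sum_fiberwise_of_maps_to (t := Finset.range (k + 1)) (g := fun t => k - t.card)
        (fun t _ => by simp), Finset.sum_range_succ, add_comm, ← Fin.sum_univ_eq_sum_range
        (fun j => ∑ t ∈ Finset.univ.powerset with k - t.card = j,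
          (∏ l ∈ t, (X l : MvPolynomial (Fin k) F)) * ∏ l ∈ Finset.univ \ t, C (r i))]
    congr 1
    · rw [Finset.sum_eq_single ∅]
      · simp
      · intro t ht ht'
        have := Finset.card_pos.2 (Finset.nonempty_iff_ne_empty.2 ht')
        have h2 := (Finset.mem_filter.1 ht).2
        have := t.card_le_univ
        simp at this
        omega
      · simp
    · refine Finset.sum_congr rfl fun j _ => ?_
      rw [esymm, Finset.smul_sum]
      refine Finset.sum_congr ?_ fun t ht => ?_
      · ext t
        have := t.card_le_univ
        simp at this
        simp [Finset.mem_powersetCard]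
        omega
      · have hc := (Finset.mem_powersetCard.1 ht).2
        have : (Finset.univ \ t).card = j := by
          rw [Finset.card_sdiff_of_subset (Finset.subset_univ _), hc]
          simp
          omega
        rw [Finset.prod_const, this, Matrix.vandermonde_apply, smul_eq_C_mul, C_pow, mul_comm]
  have hdet : IsUnit (Matrix.vandermonde r).det :=
    (Matrix.det_vandermonde_ne_zero_iff.2 hr).isUnit
  have hesymm (j : Fin k) : esymm (Fin k) F (k - j) ∈ A := by
    have h : esymm (Fin k) F (k - j) = ∑ i, (Matrix.vandermonde r)⁻¹ j i •
        (∏ l : Fin k, (C (r i) + X l) - C (r i) ^ k) := by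
      simp only [hexp, add_sub_cancel_left, Finset.smul_sum, smul_smul]
      rw [Finset.sum_comm]
      simp only [← Finset.sum_smul, ← Matrix.mul_apply, Matrix.nonsing_inv_mul _ hdet]
      simp [Matrix.one_apply]
    rw [h]
    refine sum_mem fun i _ => A.smul_mem (sub_mem (Algebra.subset_adjoin ⟨i, rfl⟩) ?_) _
    exact pow_mem (A.algebraMap_mem (r i)) k
  intro p hp
  obtain ⟨q, hq⟩ := esymmAlgHom_surjective (σ := Fin k) F (n := k) (by simp) ⟨p, hp⟩
  have hq' : p = aeval (fun i : Fin k => esymm (Fin k) F (i + 1)) q := by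
    rw [← esymmAlgHom_apply, hq]
  rw [hq']
  have h (i : Fin k) : esymm (Fin k) F (i + 1) ∈ A := by
    have := hesymm i.rev
    rwa [Fin.val_rev, Nat.sub_sub_self (by omega)] at this
  rw [aeval_def, eval₂_eq]
  exact sum_mem fun d _ => A.mul_mem (A.algebraMap_mem _) (prod_mem fun i _ => pow_mem (h i) _)

end SymmetricPolynomials

/-! ### Weak limits and density -/

section Weak

variable {E F : Type*} [NormedAddCommGroup E] [InnerProductSpace ℂ E]
  [NormedAddCommGroup F] [InnerProductSpace ℂ F]

/-- Weak convergence of a bounded family may be tested on a total set. -/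
theorem tendsto_inner_of_total {ι : Type*} {l : Filter ι} {S : Set E}
    (hS : (Submodule.span ℂ S).topologicalClosure = ⊤) {u : ι → E} {v : E} {R : ℝ}
    (hu : ∀ t, ‖u t‖ ≤ R) (h : ∀ s ∈ S, Tendsto (fun t => ⟪s, u t⟫_ℂ) l (𝓝 ⟪s, v⟫_ℂ)) (s : E) :
    Tendsto (fun t => ⟪s, u t⟫_ℂ) l (𝓝 ⟪s, v⟫_ℂ) := by
  have hequi : Equicontinuous fun t (s : E) => ⟪s, u t⟫_ℂ := by
    refine (LipschitzWith.uniformEquicontinuous _ R.toNNReal fun t => ?_).equicontinuous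
    refine LipschitzWith.of_dist_le_mul fun x y => ?_
    rw [dist_eq_norm, dist_eq_norm, ← inner_sub_left, mul_comm]
    exact (norm_inner_le_norm _ _).trans (mul_le_mul_of_nonneg_left
      ((hu t).trans (Real.le_coe_toNNReal R)) (norm_nonneg _))
  have hclosed := hequi.isClosed_setOfPred_tendsto (l := l) (f := fun s => ⟪s, v⟫_ℂ)
    (continuous_id.inner continuous_const)
  have hs : s ∈ closure (Submodule.span ℂ S : Set E) := by
    rw [← Submodule.topologicalClosure_coe, hS]; trivial
  refine closure_minimal (fun s hs => ?_) hclosed hs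
  change Tendsto (fun t => ⟪s, u t⟫_ℂ) l (𝓝 ⟪s, v⟫_ℂ)
  induction hs using Submodule.span_induction with
  | mem s hs => exact h s hs
  | zero => simpa only [inner_zero_left] using tendsto_const_nhds
  | add x y _ _ hx hy => simpa only [inner_add_left] using hx.add hy
  | smul a x _ hx => simpa only [inner_smul_left] using hx.const_mul _

/-- Closed subspaces are weakly closed. -/
theorem mem_of_tendsto_inner [CompleteSpace E] {ι : Type*} {l : Filter ι} [l.NeBot]
    {L : Submodule ℂ E} (hL : IsClosed (L : Set E)) {u : ι → E} {v : E} (hu : ∀ t, u t ∈ L)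
    (h : ∀ s, Tendsto (fun t => ⟪s, u t⟫_ℂ) l (𝓝 ⟪s, v⟫_ℂ)) : v ∈ L := by
  have : CompleteSpace L := hL.completeSpace_coe
  rw [← L.orthogonal_orthogonal, Submodule.mem_orthogonal]
  intro s hs
  refine tendsto_nhds_unique (h s) ?_
  simp only [fun t => L.inner_left_of_mem_orthogonal (hu t) hs]
  exact tendsto_const_nhds

/-- A continuous linear map sends everything into a closed subspace as soon as it does so for a
total set. -/
theorem map_mem_of_total {S : Set E} (hS : (Submodule.span ℂ S).topologicalClosure = ⊤)
    {L : Submodule ℂ F} (hL : IsClosed (L : Set F)) (f : E →L[ℂ] F) (h : ∀ s ∈ S, f s ∈ L)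
    (s : E) : f s ∈ L := by
  have hle : (Submodule.span ℂ S).topologicalClosure ≤ L.comap (f : E →ₗ[ℂ] F) :=
    Submodule.topologicalClosure_minimal _ (Submodule.span_le.2 h) (hL.preimage f.continuous)
  rw [hS] at hle
  exact hle trivial

theorem ext_of_total {S : Set E} (hS : (Submodule.span ℂ S).topologicalClosure = ⊤)
    {f g : E →L[ℂ] F} (h : ∀ s ∈ S, f s = g s) (s : E) : f s = g s :=
  DFunLike.congr_fun (ContinuousLinearMap.ext_on
    (Submodule.dense_iff_topologicalClosure_eq_top.2 hS) h) s

/-- A separately continuous multilinear map sends everything into a closed subspace as soon as it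
does so for the families of members of a total set. -/
theorem multilinear_mem_of_total {k : ℕ} {S : Set E}
    (hS : (Submodule.span ℂ S).topologicalClosure = ⊤) {L : Submodule ℂ F}
    (hL : IsClosed (L : Set F)) (f : MultilinearMap ℂ (fun _ : Fin k => E) F)
    (hf : ∀ z l, Continuous fun v => f (Function.update z l v))
    (h : ∀ z, (∀ l, z l ∈ S) → f z ∈ L) (z : Fin k → E) : f z ∈ L := by
  suffices hs : ∀ (s : Finset (Fin k)) (z : Fin k → E), (∀ l ∉ s, z l ∈ S) → f z ∈ L from
    hs Finset.univ z (by simp)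
  intro s
  induction s using Finset.induction_on with
  | empty => exact fun z hz => h z fun l => hz l (by simp)
  | insert a s ha ih =>
    intro z hz
    rw [← Function.update_eq_self a z]
    refine map_mem_of_total hS hL ⟨f.toLinearMap z a, hf z a⟩ (fun v hv => ?_) (z a)
    refine ih _ fun l hl => ?_
    rcases eq_or_ne l a with rfl | hla
    · simpa using hv
    · rw [Function.update_of_ne hla]
      exact hz l (by simp [hla, hl])

end Weak

/-! ### Cyclic subspaces -/

section Cyclic

variable {E : Type*} [NormedAddCommGroup E] [InnerProductSpace ℂ E]

/-- The group of the unitaries that map the subspace `L` onto itself. -/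
def unitaryStabilizer (L : Submodule ℂ E) : Subgroup (E ≃ₗᵢ[ℂ] E) where
  carrier := {T | ∀ z, T z ∈ L ↔ z ∈ L}
  one_mem' _ := Iff.rfl
  mul_mem' {S T} hS hT z := (hS (T z)).trans (hT z)
  inv_mem' {T} hT z := by
    rw [← hT (T⁻¹ z)]
    exact iff_of_eq (congrArg (· ∈ L) (T.apply_symm_apply z))

/-- The closed span of the orbit `U ^ n v`, `n ∈ ℤ`. -/
def cyclicSubspace (U : E ≃ₗᵢ[ℂ] E) (v : E) : Submodule ℂ E :=
  (Submodule.span ℂ (Set.range fun n : ℤ => (U ^ n) v)).topologicalClosure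

theorem isClosed_cyclicSubspace (U : E ≃ₗᵢ[ℂ] E) (v : E) :
    IsClosed (cyclicSubspace U v : Set E) :=
  Submodule.isClosed_topologicalClosure _

theorem zpow_apply_mem_cyclicSubspace (U : E ≃ₗᵢ[ℂ] E) (v : E) (n : ℤ) :
    (U ^ n) v ∈ cyclicSubspace U v :=
  Submodule.le_topologicalClosure _ (Submodule.subset_span ⟨n, rfl⟩)

theorem cyclicSubspace_inv (U : E ≃ₗᵢ[ℂ] E) (v : E) :
    cyclicSubspace U⁻¹ v = cyclicSubspace U v := by
  unfold cyclicSubspace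
  congr 2
  ext z
  constructor
  · rintro ⟨n, rfl⟩
    exact ⟨-n, by simp⟩
  · rintro ⟨n, rfl⟩
    exact ⟨-n, by simp⟩

/-- An operator that commutes with `U` and maps the generating vector into the cyclic subspace
leaves the cyclic subspace invariant. -/
theorem apply_mem_cyclicSubspace {U T : E ≃ₗᵢ[ℂ] E} {v : E} (hT : Commute T U)
    (h : T v ∈ cyclicSubspace U v) {z : E} (hz : z ∈ cyclicSubspace U v) :
    T z ∈ cyclicSubspace U v := by
  have hmap (S : E ≃ₗᵢ[ℂ] E) (w : E) (hw : ∀ n : ℤ, S ((U ^ n) v) ∈ cyclicSubspace U w)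
      (z : E) (hz : z ∈ cyclicSubspace U v) : S z ∈ cyclicSubspace U w := by
    have : cyclicSubspace U v ≤ (cyclicSubspace U w).comap (S.toLinearEquiv : E →ₗ[ℂ] E) :=
      Submodule.topologicalClosure_minimal _
        (Submodule.span_le.2 (by rintro _ ⟨n, rfl⟩; exact hw n))
        ((isClosed_cyclicSubspace U w).preimage S.continuous)
    exact this hz
  have hU (n : ℤ) (z : E) : z ∈ cyclicSubspace U v → (U ^ n) z ∈ cyclicSubspace U v :=
    hmap (U ^ n) v (fun m => by
      have := zpow_apply_mem_cyclicSubspace U v (n + m)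
      rwa [zpow_add] at this) z
  refine hmap T v (fun n => ?_) z hz
  have h1 : T ((U ^ n) v) = (U ^ n) (T v) := DFunLike.congr_fun (hT.zpow_right n).eq v
  rw [h1]
  exact hU n _ h

theorem mem_unitaryStabilizer_of_commute {U T : E ≃ₗᵢ[ℂ] E} {v : E} (hT : Commute T U)
    (h : T v ∈ cyclicSubspace U v) (h' : T⁻¹ v ∈ cyclicSubspace U v) :
    T ∈ unitaryStabilizer (cyclicSubspace U v) := fun z => by
  refine ⟨fun hz => ?_, apply_mem_cyclicSubspace hT h⟩
  have := apply_mem_cyclicSubspace hT.inv_left h' hz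
  rwa [show T⁻¹ (T z) = z from T.symm_apply_apply z] at this

theorem self_mem_unitaryStabilizer (U : E ≃ₗᵢ[ℂ] E) (v : E) :
    U ∈ unitaryStabilizer (cyclicSubspace U v) :=
  mem_unitaryStabilizer_of_commute (Commute.refl U)
    (by simpa using zpow_apply_mem_cyclicSubspace U v 1)
    (by simpa using zpow_apply_mem_cyclicSubspace U v (-1))

end Cyclic

/-! ### Elementary tensors in the Hilbert space tensor product -/

section Two

variable {E F : Type*} [NormedAddCommGroup E] [InnerProductSpace ℂ E]
  [NormedAddCommGroup F] [InnerProductSpace ℂ F]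

variable (E F) in
/-- The Hilbert space tensor product, as a type of its own, with the structure of a Hilbert space
as its only source of instances. -/
def HilbertTensor : Type _ := Completion (E ⊗[ℂ] F)

instance : NormedAddCommGroup (HilbertTensor E F) :=
  inferInstanceAs (NormedAddCommGroup (Completion (E ⊗[ℂ] F)))

instance : InnerProductSpace ℂ (HilbertTensor E F) :=
  inferInstanceAs (InnerProductSpace ℂ (Completion (E ⊗[ℂ] F)))

instance : CompleteSpace (HilbertTensor E F) :=
  inferInstanceAs (CompleteSpace (Completion (E ⊗[ℂ] F)))

variable (E F) in
/-- The inclusion of the algebraic tensor product. -/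
def HilbertTensor.ofAlg : E ⊗[ℂ] F →L[ℂ] HilbertTensor E F :=
  (Completion.toComplL : E ⊗[ℂ] F →L[ℂ] Completion (E ⊗[ℂ] F))

variable (E F) in
/-- The map `(a, b) ↦ a ⊗ b` into the Hilbert space tensor product. -/
def hilbertTmul : E →L[ℂ] F →L[ℂ] HilbertTensor E F :=
  (compL ℂ F (E ⊗[ℂ] F) (HilbertTensor E F) (HilbertTensor.ofAlg E F)).comp
    (TensorProduct.mkL ℂ E F)

theorem inner_hilbertTmul (a a' : E) (b b' : F) :
    ⟪hilbertTmul E F a b, hilbertTmul E F a' b'⟫_ℂ = ⟪a, a'⟫_ℂ * ⟪b, b'⟫_ℂ :=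
  (Completion.inner_coe (a ⊗ₜ[ℂ] b) (a' ⊗ₜ[ℂ] b')).trans (TensorProduct.inner_tmul ..)

theorem norm_hilbertTmul (a : E) (b : F) : ‖hilbertTmul E F a b‖ = ‖a‖ * ‖b‖ :=
  (Completion.norm_coe (a ⊗ₜ[ℂ] b)).trans (TensorProduct.norm_tmul ..)

theorem eq_top_of_hilbertTmul_mem {L : Submodule ℂ (HilbertTensor E F)}
    (hL : IsClosed (L : Set (HilbertTensor E F))) (h : ∀ a b, hilbertTmul E F a b ∈ L) :
    L = ⊤ := by
  refine Submodule.eq_top_iff'.2 fun z => ?_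
  refine Completion.induction_on (p := fun z : HilbertTensor E F => z ∈ L) z hL fun z => ?_
  change HilbertTensor.ofAlg E F z ∈ L
  induction z using TensorProduct.induction_on with
  | zero => rw [map_zero]; exact L.zero_mem
  | tmul a b => exact h a b
  | add x y hx hy => rw [map_add]; exact L.add_mem hx hy

theorem total_hilbertTmul :
    (Submodule.span ℂ (Set.range fun p : E × F => hilbertTmul E F p.1 p.2)).topologicalClosure =
      ⊤ :=
  eq_top_of_hilbertTmul_mem (Submodule.isClosed_topologicalClosure _) fun a b =>
    Submodule.le_topologicalClosure _ (Submodule.subset_span ⟨(a, b), rfl⟩)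

/-- Bounded weakly convergent families can be tensored. -/
theorem tendsto_inner_hilbertTmul {ι : Type*} {l : Filter ι} {a : ι → E} {a₀ : E} {b : ι → F}
    {b₀ : F} {R S : ℝ} (ha : ∀ t, ‖a t‖ ≤ R) (hb : ∀ t, ‖b t‖ ≤ S)
    (ha' : ∀ s, Tendsto (fun t => ⟪s, a t⟫_ℂ) l (𝓝 ⟪s, a₀⟫_ℂ))
    (hb' : ∀ s, Tendsto (fun t => ⟪s, b t⟫_ℂ) l (𝓝 ⟪s, b₀⟫_ℂ)) (s : HilbertTensor E F) :
    Tendsto (fun t => ⟪s, hilbertTmul E F (a t) (b t)⟫_ℂ) l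
      (𝓝 ⟪s, hilbertTmul E F a₀ b₀⟫_ℂ) := by
  refine tendsto_inner_of_total total_hilbertTmul (R := R * S) (fun t => ?_) ?_ s
  · rw [norm_hilbertTmul]
    exact mul_le_mul (ha t) (hb t) (norm_nonneg _) ((norm_nonneg _).trans (ha t))
  · rintro _ ⟨p, rfl⟩
    simp only [inner_hilbertTmul]
    exact (ha' p.1).mul (hb' p.2)

theorem unitary_ext_hilbertTmul {S T : HilbertTensor E F ≃ₗᵢ[ℂ] HilbertTensor E F}
    (h : ∀ a b, S (hilbertTmul E F a b) = T (hilbertTmul E F a b)) : S = T := by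
  ext z
  refine ext_of_total total_hilbertTmul
    (f := (S.toContinuousLinearEquiv : _ →L[ℂ] HilbertTensor E F))
    (g := (T.toContinuousLinearEquiv : _ →L[ℂ] HilbertTensor E F)) ?_ z
  rintro _ ⟨p, rfl⟩
  exact h p.1 p.2

/-- The unitary `A ⊗ B` on `HilbertTensor E F`. -/
def hilbertTensorUnitary (A : E ≃ₗᵢ[ℂ] E) (B : F ≃ₗᵢ[ℂ] F) :
    HilbertTensor E F ≃ₗᵢ[ℂ] HilbertTensor E F := tensorUnitary A B

@[simp]
theorem hilbertTensorUnitary_hilbertTmul (A : E ≃ₗᵢ[ℂ] E) (B : F ≃ₗᵢ[ℂ] F) (a : E) (b : F) :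
    hilbertTensorUnitary A B (hilbertTmul E F a b) = hilbertTmul E F (A a) (B b) :=
  completionUnitary_coe (TensorProduct.congrIsometry A B) (a ⊗ₜ b)

variable (E F) in
/-- The homomorphism `(A, B) ↦ A ⊗ B`. -/
def tensorUnitaryHom : (E ≃ₗᵢ[ℂ] E) × (F ≃ₗᵢ[ℂ] F) →*
    (HilbertTensor E F ≃ₗᵢ[ℂ] HilbertTensor E F) where
  toFun p := hilbertTensorUnitary p.1 p.2
  map_one' := unitary_ext_hilbertTmul fun a b => by simp
  map_mul' p q := unitary_ext_hilbertTmul fun a b => by simp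

end Two

/-! ### Symmetrization -/

section Power

variable {k : ℕ} {H : Type*} [NormedAddCommGroup H] [InnerProductSpace ℂ H]

theorem eq_top_of_tprod_mem {L : Submodule ℂ (TensorPower k H)}
    (hL : IsClosed (L : Set (TensorPower k H)))
    (h : ∀ z : Fin k → H, ((AlgPower.tprod z : AlgPower k H) : TensorPower k H) ∈ L) : L = ⊤ := by
  refine (Submodule.eq_top_iff'.2 fun q => ?_)
  induction q using Completion.induction_on with
  | hp => exact hL
  | ih q =>
    induction q using AlgPower.induction with
    | h c z => rw [Completion.coe_smul]; exact L.smul_mem c (h z)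
    | hadd x y hx hy => rw [Completion.coe_add]; exact L.add_mem hx hy

theorem total_tprod : (Submodule.span ℂ (Set.range fun z : Fin k → H =>
    ((AlgPower.tprod z : AlgPower k H) : TensorPower k H))).topologicalClosure = ⊤ :=
  eq_top_of_tprod_mem (Submodule.isClosed_topologicalClosure _) fun z =>
    Submodule.le_topologicalClosure _ (Submodule.subset_span ⟨z, rfl⟩)

theorem AlgPower.norm_tprod (z : Fin k → H) : ‖(AlgPower.tprod z : AlgPower k H)‖ = ∏ l, ‖z l‖ := by
  refine (sq_eq_sq₀ (norm_nonneg _) (Finset.prod_nonneg fun _ _ => norm_nonneg _)).1 ?_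
  have h : ((‖(AlgPower.tprod z : AlgPower k H)‖ : ℂ)) ^ 2 = ((∏ l, ‖z l‖ : ℝ) : ℂ) ^ 2 := by
    have := inner_self_eq_norm_sq_to_K (𝕜 := ℂ) (AlgPower.tprod z : AlgPower k H)
    rw [AlgPower.inner_tprod_tprod] at this
    simp only [inner_self_eq_norm_sq_to_K, Finset.prod_pow] at this
    simpa using this.symm
  exact_mod_cast h

theorem permUnitary_permUnitary (σ τ : Equiv.Perm (Fin k)) (q : TensorPower k H) :
    permUnitary H σ (permUnitary H τ q) = permUnitary H (τ * σ) q := by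
  refine ext_of_total total_tprod
    (f := (((permUnitary H τ).trans (permUnitary H σ)).toContinuousLinearEquiv : _ →L[ℂ] _))
    (g := ((permUnitary H (τ * σ)).toContinuousLinearEquiv : _ →L[ℂ] TensorPower k H)) ?_ q
  rintro _ ⟨z, rfl⟩
  change permUnitary H σ (permUnitary H τ _) = permUnitary H (τ * σ) _
  simp only [permUnitary_tprod, Equiv.Perm.mul_apply]

theorem sum_permUnitary_mem (q : TensorPower k H) :
    ∑ σ : Equiv.Perm (Fin k), permUnitary H σ q ∈ SymPower k H := fun σ => by
  simp only [map_sum, permUnitary_permUnitary]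
  exact Equiv.sum_comp (Equiv.mulRight σ) fun τ => permUnitary H τ q

variable (k H) in
/-- The sum of the images of a tensor under all permutations of the factors; it is `k!` times the
orthogonal projection onto the symmetric tensors. -/
def symmetrize : TensorPower k H →L[ℂ] SymPower k H :=
  (∑ σ : Equiv.Perm (Fin k), ((permUnitary H σ).toContinuousLinearEquiv :
    TensorPower k H →L[ℂ] TensorPower k H)).codRestrict (SymPower k H) fun q => by
      simpa using sum_permUnitary_mem q

theorem coe_symmetrize (q : TensorPower k H) :
    (symmetrize k H q : TensorPower k H) = ∑ σ : Equiv.Perm (Fin k), permUnitary H σ q := by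
  simp [symmetrize]

theorem symmetrize_permUnitary (σ : Equiv.Perm (Fin k)) (q : TensorPower k H) :
    symmetrize k H (permUnitary H σ q) = symmetrize k H q := by
  ext1
  simp only [coe_symmetrize, permUnitary_permUnitary]
  exact Equiv.sum_comp (Equiv.mulLeft σ) fun τ => permUnitary H τ q

theorem symmetrize_coe (s : SymPower k H) :
    symmetrize k H (s : TensorPower k H) = (k.factorial : ℂ) • s := by
  ext1
  have h (σ : Equiv.Perm (Fin k)) : permUnitary H σ (s : TensorPower k H) = s := s.2 σ
  simp [coe_symmetrize, h, Fintype.card_perm, Nat.cast_smul_eq_nsmul]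

variable (k H) in
/-- The symmetrization of an elementary tensor. -/
def symTprod : MultilinearMap ℂ (fun _ : Fin k => H) (SymPower k H) :=
  ((symmetrize k H).comp Completion.toComplL : AlgPower k H →ₗ[ℂ] SymPower k H).compMultilinearMap
    AlgPower.tprod

theorem symTprod_apply (z : Fin k → H) :
    symTprod k H z = symmetrize k H ((AlgPower.tprod z : AlgPower k H) : TensorPower k H) := rfl

theorem symTprod_comp_perm (z : Fin k → H) (σ : Equiv.Perm (Fin k)) :
    symTprod k H (fun l => z (σ l)) = symTprod k H z := by
  rw [symTprod_apply, symTprod_apply, ← permUnitary_tprod, symmetrize_permUnitary]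

theorem norm_symTprod_le (z : Fin k → H) :
    ‖symTprod k H z‖ ≤ ‖symmetrize k H‖ * ∏ l, ‖z l‖ := by
  rw [symTprod_apply, ← AlgPower.norm_tprod,
    ← Completion.norm_coe (AlgPower.tprod z : AlgPower k H)]
  exact (symmetrize k H).le_opNorm _

theorem continuous_symTprod_update (z : Fin k → H) (l : Fin k) :
    Continuous fun v => symTprod k H (Function.update z l v) := by
  refine AddMonoidHomClass.continuous_of_bound ((symTprod k H).toLinearMap z l)
    (‖symmetrize k H‖ * ∏ j ∈ Finset.univ.erase l, ‖z j‖) fun v => ?_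
  refine (norm_symTprod_le _).trans_eq ?_
  rw [← Finset.prod_erase_mul _ _ (Finset.mem_univ l), Function.update_self, mul_assoc]
  congr 2
  exact Finset.prod_congr rfl fun j hj => by rw [Function.update_of_ne (Finset.ne_of_mem_erase hj)]

@[simp]
theorem symPowerUnitary_symTprod (V : H ≃ₗᵢ[ℂ] H) (z : Fin k → H) :
    symPowerUnitary k V (symTprod k H z) = symTprod k H fun l => V (z l) := by
  ext1
  change tensorPowerUnitary k V (symTprod k H z : TensorPower k H) = _
  simp only [symTprod_apply, coe_symmetrize, map_sum, ← permUnitary_tensorPowerUnitary,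
    tensorPowerUnitary_tprod]

theorem unitary_ext_symTprod {S T : SymPower k H ≃ₗᵢ[ℂ] SymPower k H}
    (h : ∀ z, S (symTprod k H z) = T (symTprod k H z)) : S = T := by
  ext1 s
  have hs : S (symmetrize k H s) = T (symmetrize k H s) := by
    refine ext_of_total total_tprod
      (f := (S.toContinuousLinearEquiv : _ →L[ℂ] SymPower k H).comp (symmetrize k H))
      (g := (T.toContinuousLinearEquiv : _ →L[ℂ] SymPower k H).comp (symmetrize k H)) ?_ s
    rintro _ ⟨z, rfl⟩
    exact h z
  rw [symmetrize_coe, map_smul, map_smul] at hs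
  exact smul_right_injective _ (Nat.cast_ne_zero.2 k.factorial_ne_zero) hs

variable (k H) in
/-- The homomorphism `V ↦ V ⊙ ⋯ ⊙ V` (`k` factors). -/
def symPowerHom : (H ≃ₗᵢ[ℂ] H) →* (SymPower k H ≃ₗᵢ[ℂ] SymPower k H) where
  toFun := symPowerUnitary k
  map_one' := unitary_ext_symTprod fun z => by simp
  map_mul' V V' := unitary_ext_symTprod fun z => by simp

theorem tendsto_inner_symTprod {ι : Type*} {l : Filter ι} {z : ι → Fin k → H} {z₀ : Fin k → H}
    {R : Fin k → ℝ} (hz : ∀ t j, ‖z t j‖ ≤ R j)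
    (h : ∀ s j, Tendsto (fun t => ⟪s, z t j⟫_ℂ) l (𝓝 ⟪s, z₀ j⟫_ℂ)) (s : SymPower k H) :
    Tendsto (fun t => ⟪s, symTprod k H (z t)⟫_ℂ) l (𝓝 ⟪s, symTprod k H z₀⟫_ℂ) := by
  have hp (q : TensorPower k H) : Tendsto
      (fun t => ⟪q, ((AlgPower.tprod (z t) : AlgPower k H) : TensorPower k H)⟫_ℂ) l
      (𝓝 ⟪q, ((AlgPower.tprod z₀ : AlgPower k H) : TensorPower k H)⟫_ℂ) := by
    refine tendsto_inner_of_total total_tprod (R := ∏ j, R j) (fun t => ?_) ?_ q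
    · rw [Completion.norm_coe, AlgPower.norm_tprod]
      exact Finset.prod_le_prod (fun _ _ => norm_nonneg _) fun j _ => hz t j
    · rintro _ ⟨y, rfl⟩
      simp only [Completion.inner_coe, AlgPower.inner_tprod_tprod]
      exact tendsto_finsetProd _ fun j _ => h (y j) j
  have := hp (adjoint ((SymPower k H).subtypeL.comp (symmetrize k H)) s)
  simp only [adjoint_inner_left] at this
  exact this

variable (k H) in
/-- The homomorphism `(V, W) ↦ (V ⊙ ⋯ ⊙ V) ⊗ W` (`k` factors `V`). -/
def symTensorHom (K : Type*) [NormedAddCommGroup K] [InnerProductSpace ℂ K] :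
    (H ≃ₗᵢ[ℂ] H) × (K ≃ₗᵢ[ℂ] K) →*
      (HilbertTensor (SymPower k H) K ≃ₗᵢ[ℂ] HilbertTensor (SymPower k H) K) :=
  (tensorUnitaryHom (SymPower k H) K).comp ((symPowerHom k H).prodMap (MonoidHom.id _))

@[simp]
theorem symTensorHom_apply {K : Type*} [NormedAddCommGroup K] [InnerProductSpace ℂ K]
    (V : H ≃ₗᵢ[ℂ] H) (W : K ≃ₗᵢ[ℂ] K) (z : Fin k → H) (w : K) :
    symTensorHom k H K (V, W) (hilbertTmul (SymPower k H) K (symTprod k H z) w) =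
      hilbertTmul (SymPower k H) K (symTprod k H fun l => V (z l)) (W w) := by
  rw [← symPowerUnitary_symTprod]
  exact hilbertTensorUnitary_hilbertTmul ..

end Power

/-! ### Weak limits of powers -/

section PowersTendsto

variable {E : Type*} [NormedAddCommGroup E] [InnerProductSpace ℂ E]

theorem coe_pow_eq_pow_apply (U : E ≃ₗᵢ[ℂ] E) (n : ℕ) (z : E) :
    ((U.toContinuousLinearEquiv : E →L[ℂ] E) ^ n) z = (U ^ n) z := by
  induction n generalizing z with
  | zero => rfl
  | succ n ih => rw [pow_succ, pow_succ]; exact ih (U z)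

theorem powersTendstoWeakly_iff [CompleteSpace E] {U : E ≃ₗᵢ[ℂ] E} {n : ℕ → ℕ} {κ δ : ℂ} :
    PowersTendstoWeakly U n κ δ ↔ ∀ z s : E,
      Tendsto (fun t => ⟪s, (U ^ n t) z⟫_ℂ) atTop (𝓝 ⟪s, κ • z + δ • U⁻¹ z⟫_ℂ) := by
  rw [PowersTendstoWeakly, ContinuousLinearMapWOT.tendsto_iff_forall_inner_apply_tendsto]
  simp only [ContinuousLinearMapWOT.ofCLM_apply, coe_pow_eq_pow_apply]
  have h : adjoint (U.toContinuousLinearEquiv : E →L[ℂ] E) =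
      (U.symm.toContinuousLinearEquiv : E →L[ℂ] E) := U.adjoint_eq_symm
  rw [h]
  rfl

/-- Passing to adjoints in a weak limit. -/
theorem PowersTendstoWeakly.inv [CompleteSpace E] {U : E ≃ₗᵢ[ℂ] E} {n : ℕ → ℕ} {κ δ : ℂ}
    (h : PowersTendstoWeakly U n κ δ) : PowersTendstoWeakly U⁻¹ n (star κ) (star δ) := by
  rw [powersTendstoWeakly_iff] at h ⊢
  intro z s
  have hinv (T : E ≃ₗᵢ[ℂ] E) (a b : E) : ⟪a, T⁻¹ b⟫_ℂ = star ⟪b, T a⟫_ℂ := by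
    rw [RCLike.star_def, inner_conj_symm, ← T.inner_map_map a (T⁻¹ b)]
    exact congrArg _ (T.apply_symm_apply b)
  have h1 := (h s z).star
  simp only [inv_pow, hinv, inv_inv]
  convert h1 using 2
  simp only [inner_add_right, inner_smul_right, star_add, star_mul', ← hinv, inv_inv]
  rw [← inner_conj_symm s z]
  rfl

end PowersTendsto

/-! ### Polynomials in the factors, applied to a symmetric tensor -/

section OrbitTensor

open MvPolynomial

variable {k : ℕ} {H : Type*} [NormedAddCommGroup H] [InnerProductSpace ℂ H]

/-- The linear map `p ↦ p(A₀, …, A_{k-1}) (x ⊗ ⋯ ⊗ x)`, symmetrized, where `A_l` is `A` acting on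
the `l`-th factor. It sends the monomial `X ^ a` to the symmetrization of
`A ^ a 0 x ⊗ ⋯ ⊗ A ^ a (k - 1) x`. -/
def orbitTensor (A : H →ₗ[ℂ] H) (x : H) : MvPolynomial (Fin k) ℂ →ₗ[ℂ] SymPower k H :=
  (basisMonomials (Fin k) ℂ).constr ℂ fun a => symTprod k H fun l => (A ^ a l) x

theorem orbitTensor_monomial (A : H →ₗ[ℂ] H) (x : H) (a : Fin k →₀ ℕ) :
    orbitTensor A x (monomial a 1) = symTprod k H fun l => (A ^ a l) x := by
  simpa only [coe_basisMonomials, orbitTensor] using (basisMonomials (Fin k) ℂ).constr_basis ℂ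
    (fun a => symTprod k H fun l => (A ^ a l) x) a

/-- A product of polynomials in one variable each acts factor by factor. -/
theorem orbitTensor_prod_aeval (A : H →ₗ[ℂ] H) (x : H) (q : Fin k → Polynomial ℂ) :
    orbitTensor A x (∏ l, Polynomial.aeval (X l) (q l)) =
      symTprod k H fun l => Polynomial.aeval A (q l) x := by
  have h : ((orbitTensor A x).compMultilinearMap
      ((MultilinearMap.mkPiAlgebra ℂ (Fin k) (MvPolynomial (Fin k) ℂ)).compLinearMap
        fun l => (Polynomial.aeval (X l)).toLinearMap)) =
      (symTprod k H).compLinearMap fun _ =>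
        (LinearMap.applyₗ x).comp (Polynomial.aeval A).toLinearMap := by
    refine Module.Basis.ext_multilinear (fun _ => Polynomial.basisMonomials ℂ) fun v => ?_
    have hv : (∏ l, X l ^ v l : MvPolynomial (Fin k) ℂ) =
        monomial (Finsupp.equivFunOnFinite.symm v) 1 := by
      rw [monomial_eq, Finsupp.prod_fintype _ _ (by simp)]
      simp
    simp [hv, orbitTensor_monomial]
  exact DFunLike.congr_fun h q

theorem orbitTensor_prod_mul_monomial (A : H →ₗ[ℂ] H) (x : H) (κ δ : ℂ) (a : Fin k →₀ ℕ) :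
    orbitTensor A x ((∏ l, (C κ + C δ * X l)) * monomial a 1) =
      symTprod k H fun l => κ • (A ^ a l) x + δ • A ((A ^ a l) x) := by
  have h := orbitTensor_prod_aeval A x
    fun l => (Polynomial.C κ + Polynomial.C δ * Polynomial.X) * Polynomial.X ^ a l
  rw [monomial_eq, Finsupp.prod_fintype _ _ (by simp), C_1, one_mul, ← Finset.prod_mul_distrib]
  simpa [add_mul, Algebra.algebraMap_eq_smul_one] using h

theorem orbitTensor_rename (A : H →ₗ[ℂ] H) (x : H) (σ : Equiv.Perm (Fin k))
    (p : MvPolynomial (Fin k) ℂ) : orbitTensor A x (rename σ p) = orbitTensor A x p := by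
  suffices h : (orbitTensor A x).comp (rename σ).toLinearMap = orbitTensor A x from
    DFunLike.congr_fun h p
  refine (basisMonomials (Fin k) ℂ).ext fun a => ?_
  rw [coe_basisMonomials, LinearMap.comp_apply, AlgHom.toLinearMap_apply, rename_monomial,
    orbitTensor_monomial, orbitTensor_monomial,
    ← symTprod_comp_perm (fun l => (A ^ (a.mapDomain σ) l) x) σ]
  simp [Finsupp.mapDomain_apply σ.injective]

end OrbitTensor

/-! ### The invariance of the cyclic subspace -/

section SymTensor

open MvPolynomial

variable {k : ℕ} {H K : Type*} [NormedAddCommGroup H] [InnerProductSpace ℂ H]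
  [NormedAddCommGroup K] [InnerProductSpace ℂ K]

/-- The vector `p(V₀⁻¹, …, V_{k-1}⁻¹) (x ⊗ ⋯ ⊗ x) ⊗ w`, symmetrized in the first `k` factors. -/
abbrev orbitVector (V : H ≃ₗᵢ[ℂ] H) (x : H) (p : MvPolynomial (Fin k) ℂ) (w : K) :
    HilbertTensor (SymPower k H) K :=
  hilbertTmul (SymPower k H) K
    (orbitTensor ((V⁻¹ : H ≃ₗᵢ[ℂ] H).toLinearEquiv : H →ₗ[ℂ] H) x p) w

theorem tendsto_inner_symTensorHom_pow [CompleteSpace H] [CompleteSpace K] {V : H ≃ₗᵢ[ℂ] H}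
    {W : K ≃ₗᵢ[ℂ] K} {n : ℕ → ℕ} {κ δ κ' δ' : ℂ} (hV : PowersTendstoWeakly V n κ δ)
    (hW : PowersTendstoWeakly W n κ' δ') (z : Fin k → H) (w : K)
    (s : HilbertTensor (SymPower k H) K) :
    Tendsto (fun t => ⟪s, (symTensorHom k H K (V, W) ^ n t)
        (hilbertTmul (SymPower k H) K (symTprod k H z) w)⟫_ℂ) atTop
      (𝓝 ⟪s, hilbertTmul (SymPower k H) K (symTprod k H fun l => κ • z l + δ • V⁻¹ (z l))
        (κ' • w + δ' • W⁻¹ w)⟫_ℂ) := by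
  rw [powersTendstoWeakly_iff] at hV hW
  simp only [← map_pow, Prod.pow_mk, symTensorHom_apply]
  have hz (t : ℕ) : ‖symTprod k H fun l => (V ^ n t) (z l)‖ ≤
      ‖symmetrize k H‖ * ∏ l, ‖z l‖ := by
    simpa only [LinearIsometryEquiv.norm_map] using
      norm_symTprod_le fun l => (V ^ n t) (z l)
  have hsym (q : SymPower k H) := tendsto_inner_symTprod (l := atTop) (R := fun l => ‖z l‖)
    (z := fun t l => (V ^ n t) (z l)) (z₀ := fun l => κ • z l + δ • V⁻¹ (z l))
    (fun t l => ((V ^ n t).norm_map (z l)).le) (fun s l => hV (z l) s) q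
  exact tendsto_inner_hilbertTmul hz (fun t => ((W ^ n t).norm_map w).le) hsym (hW w) s

theorem tendsto_inner_orbitVector [CompleteSpace H] [CompleteSpace K] {V : H ≃ₗᵢ[ℂ] H}
    {W : K ≃ₗᵢ[ℂ] K} {n : ℕ → ℕ} {κ δ κ' δ' : ℂ} (hV : PowersTendstoWeakly V n κ δ)
    (hW : PowersTendstoWeakly W n κ' δ') (x : H) (w : K) (p : MvPolynomial (Fin k) ℂ)
    (s : HilbertTensor (SymPower k H) K) :
    Tendsto (fun t => ⟪s, (symTensorHom k H K (V, W) ^ n t) (orbitVector V x p w)⟫_ℂ)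
      atTop (𝓝 ⟪s, orbitVector V x ((∏ l, (C κ + C δ * X l)) * p) (κ' • w + δ' • W⁻¹ w)⟫_ℂ) := by
  induction p using MvPolynomial.induction_on' with
  | monomial a c =>
    have hc : monomial a c = c • (monomial a 1 : MvPolynomial (Fin k) ℂ) := by
      rw [smul_monomial, smul_eq_mul, mul_one]
    simp only [hc, orbitVector, mul_smul_comm, map_smul, _root_.smul_apply,
      inner_smul_right]
    refine Tendsto.const_mul c ?_
    simp only [orbitTensor_monomial, orbitTensor_prod_mul_monomial]
    exact tendsto_inner_symTensorHom_pow hV hW _ w s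
  | add p q hp hq =>
    -- Otherwise `map_add` would split the last factor as well.
    generalize κ' • w + δ' • W⁻¹ w = w' at hp hq ⊢
    simp only [orbitVector, mul_add, map_add, _root_.add_apply,
      inner_add_right] at hp hq ⊢
    exact hp.add hq

/-- Comparing the weak limits along two sequences, which differ by a scalar on the factor `K` only,
a closed subspace that is invariant under the powers of `V ⊙ ⋯ ⊙ V ⊗ W` is seen to be invariant
under `∏ l, (κ + δ V_l⁻¹)`. -/
theorem orbitVector_prod_mul_mem [CompleteSpace H] [CompleteSpace K] {V : H ≃ₗᵢ[ℂ] H}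
    {W : K ≃ₗᵢ[ℂ] K} {n m : ℕ → ℕ} {κ κ' δ : ℂ} (hκ : κ' ≠ κ)
    (hnV : PowersTendstoWeakly V n κ δ) (hnW : PowersTendstoWeakly W n κ δ)
    (hmV : PowersTendstoWeakly V m κ δ) (hmW : PowersTendstoWeakly W m κ' δ)
    {L : Submodule ℂ (HilbertTensor (SymPower k H) K)}
    (hL : IsClosed (L : Set (HilbertTensor (SymPower k H) K)))
    (hU : symTensorHom k H K (V, W) ∈ unitaryStabilizer L) (x : H) (w : K)
    {p : MvPolynomial (Fin k) ℂ} (hp : orbitVector V x p w ∈ L) :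
    orbitVector V x ((∏ l, (C κ + C δ * X l)) * p) w ∈ L := by
  have hpow (n : ℕ) : (symTensorHom k H K (V, W) ^ n) (orbitVector V x p w) ∈ L :=
    (pow_mem hU n _).2 hp
  have h1 := mem_of_tendsto_inner hL (fun t => hpow (n t))
    (tendsto_inner_orbitVector hnV hnW x w p)
  have h2 := mem_of_tendsto_inner hL (fun t => hpow (m t))
    (tendsto_inner_orbitVector hmV hmW x w p)
  have h3 := L.sub_mem h2 h1
  simp only [orbitVector] at h3 ⊢
  rw [← map_sub, add_sub_add_right_eq_sub, ← sub_smul, map_smul] at h3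
  exact (L.smul_mem_iff (sub_ne_zero.2 hκ)).1 h3

/-- The cyclic subspace of the symmetrization of `x ⊗ ⋯ ⊗ x ⊗ y` contains every
`p(V₀⁻¹, …, V_{k-1}⁻¹) (x ⊗ ⋯ ⊗ x) ⊗ y` for a symmetric polynomial `p`. -/
theorem orbitVector_mem_cyclicSubspace [CompleteSpace H] [CompleteSpace K] {V : H ≃ₗᵢ[ℂ] H}
    {W : K ≃ₗᵢ[ℂ] K} {n m : Fin k → ℕ → ℕ} {κ κ' δ : Fin k → ℂ}
    (hκ : ∀ i, κ' i ≠ κ i) (hδ : ∀ i, δ i ≠ 0)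
    (hnV : ∀ i, PowersTendstoWeakly V (n i) (κ i) (δ i))
    (hnW : ∀ i, PowersTendstoWeakly W (n i) (κ i) (δ i))
    (hmV : ∀ i, PowersTendstoWeakly V (m i) (κ i) (δ i))
    (hmW : ∀ i, PowersTendstoWeakly W (m i) (κ' i) (δ i))
    (hratio : Function.Injective fun i => κ i / δ i) (x : H) (y : K)
    {p : MvPolynomial (Fin k) ℂ} (hp : p.IsSymmetric) :
    orbitVector V x p y ∈ cyclicSubspace (symTensorHom k H K (V, W))
      (hilbertTmul (SymPower k H) K (symTprod k H fun _ => x) y) := by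
  set v := hilbertTmul (SymPower k H) K (symTprod k H fun _ => x) y
  set L := cyclicSubspace (symTensorHom k H K (V, W)) v
  suffices h : ∀ q, orbitVector V x q y ∈ L → orbitVector V x (p * q) y ∈ L by
    have h1 := h 1 (by
      have : orbitVector V x 1 y = v := by
        rw [orbitVector, ← C_1, ← monomial_zero', orbitTensor_monomial]
        rfl
      rw [this]
      simpa using zpow_apply_mem_cyclicSubspace (symTensorHom k H K (V, W)) v 0)
    rwa [mul_one] at h1
  have hadjoin := symmetricSubalgebra_le_adjoin hratio hp
  clear hp
  induction hadjoin using Algebra.adjoin_induction with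
  | mem p hp =>
    obtain ⟨i, rfl⟩ := hp
    intro q hq
    have h := orbitVector_prod_mul_mem (hκ i) (hnV i) (hnW i) (hmV i) (hmW i)
      (isClosed_cyclicSubspace _ v) (self_mem_unitaryStabilizer _ v) x y hq
    have hscale : (∏ l, (C (κ i) + C (δ i) * X l) : MvPolynomial (Fin k) ℂ) =
        δ i ^ k • ∏ l, (C (κ i / δ i) + X l) := by
      have hpow : C (δ i ^ k) = ∏ _l : Fin k, (C (δ i) : MvPolynomial (Fin k) ℂ) := by simp
      rw [smul_eq_C_mul, hpow, ← Finset.prod_mul_distrib]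
      simp only [mul_add, ← C_mul, mul_div_cancel₀ _ (hδ i)]
    simp only [orbitVector, hscale, smul_mul_assoc, map_smul, _root_.smul_apply] at h
    exact (L.smul_mem_iff (pow_ne_zero k (hδ i))).1 h
  | algebraMap c =>
    intro q hq
    rw [← Algebra.smul_def]
    simp only [orbitVector, map_smul, _root_.smul_apply]
    exact L.smul_mem c hq
  | add p p' _ _ hp hp' =>
    intro q hq
    simp only [orbitVector, add_mul, map_add, _root_.add_apply]
    exact L.add_mem (hp q hq) (hp' q hq)
  | mul p p' _ _ hp hp' =>
    intro q hq
    rw [mul_assoc]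
    exact hp _ (hp' q hq)

theorem coe_pow_linearEquiv_apply (A : H ≃ₗᵢ[ℂ] H) (n : ℕ) (z : H) :
    ((A.toLinearEquiv : H →ₗ[ℂ] H) ^ n) z = (A ^ n) z := by
  induction n generalizing z with
  | zero => rfl
  | succ n ih => rw [pow_succ, pow_succ]; exact ih (A z)

/-- `orbitVector_mem_cyclicSubspace` for the symmetric polynomial `∑ σ, σ (X ^ a)`. -/
theorem symTprod_inv_pow_mem_cyclicSubspace [CompleteSpace H] [CompleteSpace K] {V : H ≃ₗᵢ[ℂ] H}
    {W : K ≃ₗᵢ[ℂ] K} {n m : Fin k → ℕ → ℕ} {κ κ' δ : Fin k → ℂ}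
    (hκ : ∀ i, κ' i ≠ κ i) (hδ : ∀ i, δ i ≠ 0)
    (hnV : ∀ i, PowersTendstoWeakly V (n i) (κ i) (δ i))
    (hnW : ∀ i, PowersTendstoWeakly W (n i) (κ i) (δ i))
    (hmV : ∀ i, PowersTendstoWeakly V (m i) (κ i) (δ i))
    (hmW : ∀ i, PowersTendstoWeakly W (m i) (κ' i) (δ i))
    (hratio : Function.Injective fun i => κ i / δ i) (x : H) (y : K) (a : Fin k → ℕ) :
    hilbertTmul (SymPower k H) K (symTprod k H fun l => (V⁻¹ ^ a l) x) y ∈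
      cyclicSubspace (symTensorHom k H K (V, W))
        (hilbertTmul (SymPower k H) K (symTprod k H fun _ => x) y) := by
  set b : Fin k →₀ ℕ := Finsupp.equivFunOnFinite.symm a
  have hp : (∑ σ : Equiv.Perm (Fin k),
      rename σ (monomial b 1 : MvPolynomial (Fin k) ℂ)).IsSymmetric := fun τ => by
    simp only [map_sum, rename_rename]
    exact Equiv.sum_comp (Equiv.mulLeft τ)
      fun σ => rename σ (monomial b 1 : MvPolynomial (Fin k) ℂ)
  have h := orbitVector_mem_cyclicSubspace hκ hδ hnV hnW hmV hmW hratio x y hp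
  simp only [orbitVector, map_sum, orbitTensor_rename, Finset.sum_const, Finset.card_univ,
    Fintype.card_perm, Fintype.card_fin, map_nsmul, orbitTensor_monomial,
    coe_pow_linearEquiv_apply] at h
  rw [← Nat.cast_smul_eq_nsmul ℂ, _root_.smul_apply,
    Submodule.smul_mem_iff _ (Nat.cast_ne_zero.2 k.factorial_ne_zero)] at h
  exact h

/-- The vectors `V ^ c 0 x ⊗ ⋯ ⊗ V ^ c (k - 1) x ⊗ W ^ b y`, symmetrized in the first `k` factors,
are total. -/
theorem eq_top_of_symTprod_zpow_mem {V : H ≃ₗᵢ[ℂ] H} {W : K ≃ₗᵢ[ℂ] K} {x : H} {y : K}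
    (hx : (Submodule.span ℂ (Set.range fun n : ℤ => (V ^ n) x)).topologicalClosure = ⊤)
    (hy : (Submodule.span ℂ (Set.range fun n : ℤ => (W ^ n) y)).topologicalClosure = ⊤)
    {L : Submodule ℂ (HilbertTensor (SymPower k H) K)}
    (hL : IsClosed (L : Set (HilbertTensor (SymPower k H) K)))
    (h : ∀ (c : Fin k → ℤ) (b : ℤ),
      hilbertTmul (SymPower k H) K (symTprod k H fun l => (V ^ c l) x) ((W ^ b) y) ∈ L) :
    L = ⊤ := by
  have h1 (c : Fin k → ℤ) (w : K) :
      hilbertTmul (SymPower k H) K (symTprod k H fun l => (V ^ c l) x) w ∈ L := by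
    refine map_mem_of_total hy hL _ ?_ w
    rintro _ ⟨b, rfl⟩
    exact h c b
  have h2 (w : K) (z : Fin k → H) : hilbertTmul (SymPower k H) K (symTprod k H z) w ∈ L := by
    refine multilinear_mem_of_total hx hL
      ((((hilbertTmul (SymPower k H) K).flip w : SymPower k H →L[ℂ] _) :
        SymPower k H →ₗ[ℂ] HilbertTensor (SymPower k H) K).compMultilinearMap (symTprod k H))
      (fun z l => ((hilbertTmul (SymPower k H) K).flip w).continuous.comp
        (continuous_symTprod_update z l)) (fun z hz => ?_) z
    choose c hc using hz
    obtain rfl : (fun l => (V ^ c l) x) = z := funext hc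
    exact h1 c w
  refine eq_top_of_hilbertTmul_mem hL fun s w => ?_
  have h3 : hilbertTmul (SymPower k H) K (symmetrize k H s) w ∈ L := by
    refine map_mem_of_total total_tprod hL
      (((hilbertTmul (SymPower k H) K).flip w).comp (symmetrize k H)) ?_ s
    rintro _ ⟨z, rfl⟩
    exact h2 w z
  rw [symmetrize_coe, map_smul, _root_.smul_apply] at h3
  exact (L.smul_mem_iff (Nat.cast_ne_zero.2 k.factorial_ne_zero)).1 h3

end SymTensor

end SimpleSpectrum

end

theorem lemma2p2 {H K : Type*}
    [NormedAddCommGroup H] [InnerProductSpace ℂ H] [CompleteSpace H]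
    [NormedAddCommGroup K] [InnerProductSpace ℂ K] [CompleteSpace K]
    (V : H ≃ₗᵢ[ℂ] H) (W : K ≃ₗᵢ[ℂ] K)
    (hV : SimpleSpectrum.HasSimpleSpectrum V) (hW : SimpleSpectrum.HasSimpleSpectrum W)
    (k : ℕ) (n m : Fin k → ℕ → ℕ) (κ κ' δ : Fin k → ℂ)
    (hn : ∀ i, Tendsto (n i) atTop atTop) (hm : ∀ i, Tendsto (m i) atTop atTop)
    (hκ : ∀ i, κ' i ≠ κ i) (hδ : ∀ i, δ i ≠ 0)
    (hnV : ∀ i, SimpleSpectrum.PowersTendstoWeakly V (n i) (κ i) (δ i))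
    (hnW : ∀ i, SimpleSpectrum.PowersTendstoWeakly W (n i) (κ i) (δ i))
    (hmV : ∀ i, SimpleSpectrum.PowersTendstoWeakly V (m i) (κ i) (δ i))
    (hmW : ∀ i, SimpleSpectrum.PowersTendstoWeakly W (m i) (κ' i) (δ i))
    (hratio : Function.Injective fun i => κ i / δ i) :
    SimpleSpectrum.HasSimpleSpectrum
      (SimpleSpectrum.tensorUnitary (SimpleSpectrum.symPowerUnitary k V) W) := by
  open SimpleSpectrum in
  obtain ⟨x, hx⟩ := hV
  obtain ⟨y, hy⟩ := hW
  set v := hilbertTmul (SymPower k H) K (symTprod k H fun _ => x) y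
  set L := cyclicSubspace (symTensorHom k H K (V, W)) v
  suffices h : L = ⊤ from ⟨v, h⟩
  have hneg := symTprod_inv_pow_mem_cyclicSubspace hκ hδ hnV hnW hmV hmW hratio x y
  -- The adjoint relations give the same for the positive powers, since the cyclic subspace of the
  -- inverse is the same.
  have hpos := symTprod_inv_pow_mem_cyclicSubspace (fun i => star_injective.ne (hκ i))
    (fun i => star_ne_zero.2 (hδ i)) (fun i => (hnV i).inv) (fun i => (hnW i).inv)
    (fun i => (hmV i).inv) (fun i => (hmW i).inv)
    (fun i j hij => hratio (star_injective (by simpa only [star_div₀] using hij))) x y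
  rw [← Prod.inv_mk, map_inv, cyclicSubspace_inv] at hpos
  have hU := self_mem_unitaryStabilizer (symTensorHom k H K (V, W)) v
  have hR : symTensorHom k H K (V, 1) ∈ unitaryStabilizer L := by
    refine mem_unitaryStabilizer_of_commute (Commute.map ?_ (symTensorHom k H K)) ?_ ?_
    · exact Prod.ext rfl ((Commute.one_left W).eq)
    · rw [symTensorHom_apply]
      simpa using hpos fun _ => 1
    · rw [← map_inv, Prod.inv_mk, symTensorHom_apply]
      simpa using hneg fun _ => 1
  refine eq_top_of_symTprod_zpow_mem hx hy (isClosed_cyclicSubspace _ v) fun c b => ?_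
  -- All exponents `c l` are at most `N`, so that the vector comes from one with the nonpositive
  -- exponents `c l - N`.
  obtain ⟨N, hN⟩ : ∃ N : ℤ, ∀ l, c l ≤ N := by
    obtain ⟨N, hN⟩ := (Set.finite_range c).bddAbove
    exact ⟨N, fun l => hN ⟨l, rfl⟩⟩
  have hT : symTensorHom k H K (V ^ N, W ^ b) ∈ unitaryStabilizer L := by
    have : ((V ^ N, W ^ b) : (H ≃ₗᵢ[ℂ] H) × (K ≃ₗᵢ[ℂ] K)) =
        (V, 1) ^ N * ((V, 1)⁻¹ * (V, W)) ^ b := by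
      ext1 <;> simp
    rw [this, map_mul, map_zpow, map_zpow, map_mul, map_inv]
    exact mul_mem (zpow_mem hR N) (zpow_mem (mul_mem (inv_mem hR) hU) b)
  have h := (hT _).2 (hneg fun l => (N - c l).toNat)
  rw [symTensorHom_apply] at h
  convert h using 4
  funext l
  rw [← zpow_natCast, Int.toNat_of_nonneg (sub_nonneg.2 (hN l)), inv_zpow', neg_sub]
  change _ = (V ^ N * V ^ (c l - N)) x
  rw [← zpow_add, add_sub_cancel]
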